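/- Let $s,d$ be integers with $1\le s\le d$ and let $\sigma>0$. One observes $y_j=\theta_j+\sigma\xi_j$, $j=1,\dots,d$, where $\theta=(\theta_1,\dots,\theta_d)\in\mathbb R^d$ is unknown and $\xi_1,\dots,\xi_d$ are i.i.d. standard normal random variables; $\mathbf E_\theta$ denotes the expectation with respect to the law of $y=(y_1,\dots,y_d)$. Let $B_0(s)$ be the set of all $\theta\in\mathbb R^d$ with at most $s$ non-zero components, and put $$\psi_\sigma(s,d)=\begin{cases}\sigma^2 s\log(1+d/s^2) & \text{if } s<\sqrt d,\\ \sigma^2\sqrt d & \text{if } s\ge\sqrt d.\end{cases}$$ Let $x=\sqrt{2\log(1+d/s^2)}$, let $\alpha_s=\mathbf E(X^2\mid |X|>x)$ for a standard normal random variable $X$, and define the estimator $\hat N=\sqrt{\max\{\hat Q,0\}}$, where $$\hat Q=\begin{cases}\sum_{j=1}^d (y_j^2-\alpha_s\sigma^2)\,\mathbf 1_{\{|y_j|>\sigma x\}} & \text{if } s<\sqrt d,\\ \sum_{j=1}^d y_j^2-d\sigma^2 & \text{if } s\ge\sqrt d.\end{cases}$$ Then there exist absolute constants $c>0$ and $C>0$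 such that, for all integers $s,d$ with $1\le s\le d$ and all $\sigma>0$, the function $\hat N$ of $y$ is measurable, $$\sup_{\theta\in B_0(s)}\mathbf E_\theta\big(\hat N-\|\theta\|_2\big)^2\le C\,\psi_\sigma(s,d),$$ and $$\inf_{\hat T}\ \sup_{\theta\in B_0(s)}\mathbf E_\theta\big(\hat T-\|\theta\|_2\big)^2\ge c\,\psi_\sigma(s,d),$$ where the infimum is over all estimators $\hat T$, that is, over all measurable real-valued functions of $y$. -/

import Mathlib

open MeasureTheory ProbabilityTheory

noncomputable section

namespace SparseNorm

/-- The law `P_θ` of the observations `y_j = θ_j + σ ξ_j`, `j = 1, …, d`, where the `ξ_j` are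
i.i.d. standard normal. -/
def obsLaw {d : ℕ} (θ : EuclideanSpace ℝ (Fin d)) (σ : ℝ) : Measure (Fin d → ℝ) :=
  (Measure.pi fun _ : Fin d => gaussianReal 0 1).map fun ξ j => θ j + σ * ξ j

/-- The class `B_0(s)` of vectors with at most `s` non-zero components. -/
def sparseClass (s d : ℕ) : Set (EuclideanSpace ℝ (Fin d)) :=
  {θ | hammingNorm (fun j => θ j) ≤ s}

/-- The maximum squared risk over `Θ` of `That` as an estimator of the functional `T`. It takes
values in `[0, ∞]`, so no integrability has to be presupposed. -/
def maxRisk {d : ℕ} (σ : ℝ) (Θ : Set (EuclideanSpace ℝ (Fin d)))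
    (T : EuclideanSpace ℝ (Fin d) → ℝ) (That : (Fin d → ℝ) → ℝ) : ENNReal :=
  ⨆ θ ∈ Θ, ∫⁻ y, ENNReal.ofReal ((That y - T θ) ^ 2) ∂(obsLaw θ σ)

/-- The minimax squared risk over `Θ` for the functional `T`: the infimum of the maximum risk over
all estimators, that is, over all measurable functions of the observations. -/
def minimaxRisk {d : ℕ} (σ : ℝ) (Θ : Set (EuclideanSpace ℝ (Fin d)))
    (T : EuclideanSpace ℝ (Fin d) → ℝ) : ENNReal :=
  ⨅ (That : (Fin d → ℝ) → ℝ) (_ : Measurable That), maxRisk σ Θ T That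

/-- The number `√(2 log (1 + d / s²))`. -/
def threshold (s d : ℕ) : ℝ :=
  √(2 * Real.log (1 + (d : ℝ) / (s : ℝ) ^ 2))

/-- The conditional second moment `E (X² | |X| > x)` with `x = √(2 log (1 + d / s²))`, for a
standard normal variable `X`. -/
def alpha (s d : ℕ) : ℝ :=
  (∫ x in {x : ℝ | threshold s d < |x|}, x ^ 2 ∂(gaussianReal 0 1)) /
    (gaussianReal 0 1).real {x : ℝ | threshold s d < |x|}

/-- The estimator of `‖θ‖₂²`: thresholded and bias-corrected for `s < √d`, and only bias-corrected
for `s ≥ √d`. -/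
def quadEstimator (s d : ℕ) (σ : ℝ) (y : Fin d → ℝ) : ℝ :=
  if (s : ℝ) < √(d : ℝ) then
    ∑ j, if σ * threshold s d < |y j| then y j ^ 2 - alpha s d * σ ^ 2 else 0
  else
    ∑ j, y j ^ 2 - d * σ ^ 2

/-- The estimator of `‖θ‖₂`. -/
def normEstimator (s d : ℕ) (σ : ℝ) (y : Fin d → ℝ) : ℝ :=
  √(max (quadEstimator s d σ y) 0)

/-- The rate: `σ² s log (1 + d / s²)` if `s < √d`, and `σ² √d` if `s ≥ √d`. -/
def normRate (s d : ℕ) (σ : ℝ) : ℝ :=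
  if (s : ℝ) < √(d : ℝ) then
    σ ^ 2 * s * Real.log (1 + (d : ℝ) / (s : ℝ) ^ 2)
  else
    σ ^ 2 * √(d : ℝ)

end SparseNorm

end

noncomputable section

namespace SparseNorm

/-! Both bounds scale like `σ ^ 2`, so everything reduces to `σ = 1`.

Lower bound: zero is compared with a uniform mixture of `s`-sparse vectors of equal norm `r`, one
spike of height `a` in each of `s` disjoint blocks of length `m = d / s`. By Cameron-Martin the
second moment of the likelihood ratio is the mean of `exp ⟨u k, u k'⟩`; with `exp (a ^ 2) = 1 + m /
s` it equals `(1 + 1 / s) ^ s ≤ e < 4`, so the hypotheses are not separated and the risk is of order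
`r ^ 2 = s * a ^ 2` (`two_point_lower_bound`, `sparse_block_lower_bound`). For `s ≥ √d` the smaller
class with sparsity `⌊√d⌋` already gives the rate.

Upper bound: `(√a - √b) ^ 2 ≤ |a - b|` turns errors on squared norms into squared errors on norms.
In the sparse zone (`sparse_upper_bound`) the comparison point is the thresholded observation
restricted to the support of `η`. Noise off the support is centred by the choice of `alpha` and has
variance at most a multiple of `d * exp (-x ^ 2 / 2) ≤ s ^ 2`; each support coordinate costs order
`x ^ 2`. In the dense zone (`dense_upper_bound`) the cross term is proportional to `‖η‖`, and
dividing by `‖η‖` when taking the root keeps the risk bounded uniformly in `η`. -/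

/-- The law of `d` independent standard normal variables. -/
abbrev stdGaussianPi (d : ℕ) : Measure (Fin d → ℝ) :=
  Measure.pi fun _ : Fin d => gaussianReal 0 1

/-! ### Gaussian exponential moments and shifts. -/

lemma integrable_exp_linear_stdGaussianPi {d : ℕ} (u : Fin d → ℝ) (b : ℝ) :
    Integrable (fun ξ => Real.exp (∑ j, u j * ξ j - b)) (stdGaussianPi d) := by
  have h : (fun ξ : Fin d → ℝ => Real.exp (∑ j, u j * ξ j - b)) =
      fun ξ => (∏ j, Real.exp (u j * ξ j)) * Real.exp (-b) := by
    ext ξ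
    rw [sub_eq_add_neg, Real.exp_add, Real.exp_sum]
  rw [h]
  exact (Integrable.fintype_prod (f := fun j x => Real.exp (u j * x))
    fun j => integrable_exp_mul_gaussianReal (u j)).mul_const _

lemma integral_exp_linear_stdGaussianPi {d : ℕ} (u : Fin d → ℝ) (b : ℝ) :
    ∫ ξ, Real.exp (∑ j, u j * ξ j - b) ∂(stdGaussianPi d) =
      Real.exp ((∑ j, u j ^ 2) / 2 - b) := by
  have h : (fun ξ : Fin d → ℝ => Real.exp (∑ j, u j * ξ j - b)) =
      fun ξ => (∏ j, Real.exp (u j * ξ j)) * Real.exp (-b) := by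
    ext ξ
    rw [sub_eq_add_neg, Real.exp_add, Real.exp_sum]
  rw [h, integral_mul_const, integral_fintype_prod_eq_prod (f := fun j x => Real.exp (u j * x))]
  have h1 : ∀ t : ℝ, ∫ x, Real.exp (t * x) ∂(gaussianReal 0 1) = Real.exp (t ^ 2 / 2) := by
    intro t
    have := congrFun (mgf_id_gaussianReal (μ := 0) (v := 1)) t
    simpa [mgf] using this
  simp_rw [h1]
  rw [← Real.exp_sum, ← Finset.sum_div, ← Real.exp_add, sub_eq_add_neg]

lemma gaussianReal_apply_eq_integral_exp (a : ℝ) {A : Set ℝ} (hA : MeasurableSet A) :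
    gaussianReal a 1 A =
      ENNReal.ofReal (∫ x, A.indicator (fun x => Real.exp (a * x - a ^ 2 / 2)) x
        ∂(gaussianReal 0 1)) := by
  rw [gaussianReal_apply_eq_integral a one_ne_zero, ← integral_indicator hA,
    integral_gaussianReal_eq_integral_smul one_ne_zero]
  congr 2
  ext x
  by_cases hx : x ∈ A
  · simp only [Set.indicator_of_mem hx, gaussianPDFReal, smul_eq_mul, mul_assoc]
    rw [← Real.exp_add]
    congr 2
    simp
    ring
  · simp [hx]

/-- The Cameron-Martin formula for the standard Gaussian law. -/
lemma map_add_stdGaussianPi {d : ℕ} (u : Fin d → ℝ) :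
    (stdGaussianPi d).map (fun ξ j => u j + ξ j) =
      (stdGaussianPi d).withDensity
        fun ξ => ENNReal.ofReal (Real.exp (∑ j, u j * ξ j - (∑ j, u j ^ 2) / 2)) := by
  have h1 : (stdGaussianPi d).map (fun ξ j => u j + ξ j) =
      Measure.pi fun j => gaussianReal (u j) 1 := by
    rw [Measure.pi_map_pi (μ := fun _ : Fin d => gaussianReal 0 1)
      (f := fun j x => u j + x) (fun j => by fun_prop)]
    congr 1
    ext1 j
    rw [gaussianReal_map_const_add, zero_add]
  rw [h1]
  -- It suffices to compare on boxes, where the exponential weight factorises over coordinates.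
  refine Measure.pi_eq fun A hA => ?_
  have hAm : MeasurableSet (Set.univ.pi A) := MeasurableSet.univ_pi hA
  rw [withDensity_apply _ hAm, ← ofReal_integral_eq_lintegral_ofReal
    ((integrable_exp_linear_stdGaussianPi u _).integrableOn)
    (Filter.Eventually.of_forall fun _ => (Real.exp_pos _).le), ← integral_indicator hAm]
  simp_rw [gaussianReal_apply_eq_integral_exp _ (hA _)]
  rw [← ENNReal.ofReal_prod_of_nonneg, ← integral_fintype_prod_eq_prod
    (f := fun j x => (A j).indicator (fun x => Real.exp (u j * x - u j ^ 2 / 2)) x)]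
  · congr 2
    ext ξ
    by_cases h : ξ ∈ Set.univ.pi A
    · rw [Set.indicator_of_mem h, Finset.prod_congr rfl fun j _ =>
        Set.indicator_of_mem (h j (Set.mem_univ j)) _, ← Real.exp_sum, Finset.sum_sub_distrib,
        Finset.sum_div]
    · rw [Set.indicator_of_notMem h]
      obtain ⟨j, hj⟩ : ∃ j, ξ j ∉ A j := by simpa [Set.mem_pi] using h
      exact (Finset.prod_eq_zero (Finset.mem_univ j) (Set.indicator_of_notMem hj _)).symm
  · intro j _
    exact integral_nonneg fun x => Set.indicator_nonneg (fun _ _ => (Real.exp_pos _).le) _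

lemma lintegral_add_stdGaussianPi {d : ℕ} (u : Fin d → ℝ) {F : (Fin d → ℝ) → ENNReal}
    (hF : Measurable F) :
    ∫⁻ ξ, F (fun j => u j + ξ j) ∂(stdGaussianPi d) =
      ∫⁻ ξ, ENNReal.ofReal (Real.exp (∑ j, u j * ξ j - (∑ j, u j ^ 2) / 2)) * F ξ
        ∂(stdGaussianPi d) := by
  have h := lintegral_map (μ := stdGaussianPi d) (g := fun ξ j => u j + ξ j) hF (by fun_prop)
  rw [← h, map_add_stdGaussianPi, lintegral_withDensity_eq_lintegral_mul _ (by fun_prop) hF]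
  rfl

/-! ### Sums of functions of independent coordinates. -/

lemma integrable_comp_eval_stdGaussianPi {d : ℕ} (j : Fin d) {g : ℝ → ℝ}
    (hg : Integrable g (gaussianReal 0 1)) :
    Integrable (fun ξ => g (ξ j)) (stdGaussianPi d) :=
  integrable_comp_eval (μ := fun _ : Fin d => gaussianReal 0 1) hg

lemma integral_comp_eval_stdGaussianPi {d : ℕ} (j : Fin d) {g : ℝ → ℝ}
    (hg : Integrable g (gaussianReal 0 1)) :
    ∫ ξ, g (ξ j) ∂(stdGaussianPi d) = ∫ x, g x ∂(gaussianReal 0 1) :=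
  integral_comp_eval (μ := fun _ : Fin d => gaussianReal 0 1) hg.1

lemma memLp_sum_comp_eval_stdGaussianPi {d : ℕ} {g : Fin d → ℝ → ℝ}
    (hg : ∀ j, MemLp (g j) 2 (gaussianReal 0 1)) :
    MemLp (fun ξ => ∑ j, g j (ξ j)) 2 (stdGaussianPi d) :=
  memLp_finsetSum _ fun j _ => (hg j).comp_measurePreserving
    (measurePreserving_eval (fun _ : Fin d => gaussianReal 0 1) j)

/-- The second moment of a sum of centred functions of distinct coordinates. -/
lemma integral_sq_sum_stdGaussianPi {d : ℕ} {g : Fin d → ℝ → ℝ}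
    (hg : ∀ j, MemLp (g j) 2 (gaussianReal 0 1))
    (hg0 : ∀ j, ∫ x, g j x ∂(gaussianReal 0 1) = 0) :
    ∫ ξ, (∑ j, g j (ξ j)) ^ 2 ∂(stdGaussianPi d) = ∑ j, ∫ x, g j x ^ 2 ∂(gaussianReal 0 1) := by
  have h := variance_sum_pi (μ := fun _ : Fin d => gaussianReal 0 1) (X := g) hg
  have h1 : ∀ j, Var[g j; gaussianReal 0 1] = ∫ x, g j x ^ 2 ∂(gaussianReal 0 1) := fun j =>
    variance_of_integral_eq_zero (hg j).1.aemeasurable (hg0 j)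
  simp_rw [h1] at h
  have h2 : (∑ j, fun ξ : Fin d → ℝ => g j (ξ j)) = fun ξ => ∑ j, g j (ξ j) := by
    ext ξ; simp
  rw [h2, variance_of_integral_eq_zero] at h
  · exact h
  · exact (memLp_sum_comp_eval_stdGaussianPi hg).1.aemeasurable
  · rw [integral_finsetSum]
    · exact Finset.sum_eq_zero fun j _ => by
        rw [integral_comp_eval_stdGaussianPi j ((hg j).integrable one_le_two), hg0 j]
    · exact fun j _ => integrable_comp_eval_stdGaussianPi j ((hg j).integrable one_le_two)

/-! ### Reduction to unit noise. -/

lemma lintegral_obsLaw {d : ℕ} (θ : EuclideanSpace ℝ (Fin d)) (σ : ℝ)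
    {F : (Fin d → ℝ) → ENNReal} (hF : Measurable F) :
    ∫⁻ y, F y ∂(obsLaw θ σ) = ∫⁻ ξ, F (fun j => θ j + σ * ξ j) ∂(stdGaussianPi d) :=
  lintegral_map hF (by fun_prop)

lemma lintegral_risk_smul {d : ℕ} {σ : ℝ} (hσ : 0 < σ) (η : EuclideanSpace ℝ (Fin d))
    {T : (Fin d → ℝ) → ℝ} (hT : Measurable T) :
    ∫⁻ y, ENNReal.ofReal ((T y - ‖σ • η‖) ^ 2) ∂(obsLaw (σ • η) σ) =
      ENNReal.ofReal (σ ^ 2) * ∫⁻ ξ, ENNReal.ofReal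
        ((T (fun j => σ * (η j + ξ j)) / σ - ‖η‖) ^ 2) ∂(stdGaussianPi d) := by
  rw [lintegral_obsLaw _ _ (by fun_prop), ← lintegral_const_mul _ (by fun_prop)]
  refine lintegral_congr fun ξ => ?_
  rw [← ENNReal.ofReal_mul (sq_nonneg σ), norm_smul, Real.norm_of_nonneg hσ.le]
  congr 1
  have : (fun j => (σ • η) j + σ * ξ j) = fun j => σ * (η j + ξ j) := by
    ext j
    simp
    ring
  rw [this]
  field_simp

lemma smul_mem_sparseClass {s d : ℕ} (c : ℝ) {θ : EuclideanSpace ℝ (Fin d)}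
    (hθ : θ ∈ sparseClass s d) : c • θ ∈ sparseClass s d := by
  refine le_trans (Finset.card_le_card fun j => ?_) hθ
  simp only [Finset.mem_filter, Finset.mem_univ, true_and]
  intro h h0
  simp [h0] at h

/-! ### The lower bound. -/

/-- The sum factorises over `i`: in each coordinate one choice agrees with `k i` and `m - 1` do not.
This evaluates the second moment of the mixture over spike positions. -/
lemma sum_prod_ite_eq {s m : ℕ} (c : ℝ) (k : Fin s → Fin m) :
    ∑ k' : Fin s → Fin m, ∏ i, (if k' i = k i then c else 1) = (m - 1 + c) ^ s := by
  have h := Finset.prod_univ_sum (fun _ : Fin s => (Finset.univ : Finset (Fin m)))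
    (fun i l => if l = k i then c else (1 : ℝ))
  rw [Fintype.piFinset_univ] at h
  rw [← h]
  have h1 : ∀ i, ∑ l : Fin m, (if l = k i then c else (1 : ℝ)) = m - 1 + c := by
    intro i
    have : ∀ l : Fin m, (if l = k i then c else (1 : ℝ)) = 1 + if l = k i then c - 1 else 0 := by
      intro l; split_ifs <;> ring
    simp_rw [this, Finset.sum_add_distrib]
    simp
    ring
  simp [h1]

/-- If the average likelihood ratio of finitely many shifts `u k` has second moment at most `B`,
then no function of the observations estimates both the value `0` at `0` and
the common value `r` at all of these shifts well. -/
lemma two_point_lower_bound {d : ℕ} {K : Type*} [Fintype K] [Nonempty K] (u : K → Fin d → ℝ)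
    {B r : ℝ} (hB : ∑ k, ∑ k', Real.exp (∑ j, u k j * u k' j) ≤ B * Fintype.card K ^ 2)
    {G : (Fin d → ℝ) → ℝ} (hG : Measurable G) {R : ENNReal}
    (h0 : ∫⁻ ξ, ENNReal.ofReal (G ξ ^ 2) ∂(stdGaussianPi d) ≤ R)
    (h1 : ∀ k, ∫⁻ ξ, ENNReal.ofReal ((G (fun j => u k j + ξ j) - r) ^ 2) ∂(stdGaussianPi d) ≤ R) :
    ENNReal.ofReal ((1 - B / 4) / 4 * r ^ 2) ≤ R := by
  set M : ℝ := (Fintype.card K : ℝ) with hM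
  have hMpos : 0 < M := by
    rw [hM]; exact_mod_cast Fintype.card_pos
  set w : K → (Fin d → ℝ) → ℝ := fun k ξ =>
    Real.exp (∑ j, u k j * ξ j - (∑ j, u k j ^ 2) / 2) with hw
  have hwpos : ∀ k ξ, 0 < w k ξ := fun k ξ => Real.exp_pos _
  have hwm : ∀ k, Measurable (w k) := fun k => by rw [hw]; fun_prop
  set f : (Fin d → ℝ) → ℝ := fun ξ => ∑ k, M⁻¹ * w k ξ with hf
  have hfnn : ∀ ξ, 0 ≤ f ξ := fun ξ =>
    Finset.sum_nonneg fun k _ => mul_nonneg (inv_nonneg.2 hMpos.le) (hwpos k ξ).le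
  have hwint : ∀ k, Integrable (w k) (stdGaussianPi d) := fun k =>
    integrable_exp_linear_stdGaussianPi _ _
  have hfint : Integrable f (stdGaussianPi d) :=
    integrable_finsetSum _ fun k _ => (hwint k).const_mul _
  have hf1 : ∫ ξ, f ξ ∂(stdGaussianPi d) = 1 := by
    rw [hf, integral_finsetSum _ fun k _ => (hwint k).const_mul _]
    have : ∀ k, ∫ ξ, M⁻¹ * w k ξ ∂(stdGaussianPi d) = M⁻¹ := fun k => by
      rw [integral_const_mul, hw, integral_exp_linear_stdGaussianPi]
      simp
    simp_rw [this]
    simp [← hM, hMpos.ne']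
  have hww : ∀ k k' ξ, w k ξ * w k' ξ = Real.exp (∑ j, (u k j + u k' j) * ξ j -
      ((∑ j, u k j ^ 2) / 2 + (∑ j, u k' j ^ 2) / 2)) := fun k k' ξ => by
    rw [hw, ← Real.exp_add]
    congr 1
    simp_rw [add_mul, Finset.sum_add_distrib]
    ring
  have hf2' : ∀ ξ, f ξ ^ 2 = ∑ k, ∑ k', M⁻¹ ^ 2 * (w k ξ * w k' ξ) := fun ξ => by
    rw [sq, hf, Finset.sum_mul_sum]
    refine Finset.sum_congr rfl fun k _ => Finset.sum_congr rfl fun k' _ => by ring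
  have hwwint : ∀ k k', Integrable (fun ξ => M⁻¹ ^ 2 * (w k ξ * w k' ξ)) (stdGaussianPi d) :=
    fun k k' => by
      simp_rw [hww]
      exact (integrable_exp_linear_stdGaussianPi _ _).const_mul _
  have hf2int : Integrable (fun ξ => f ξ ^ 2) (stdGaussianPi d) := by
    simp_rw [hf2']
    exact integrable_finsetSum _ fun k _ => integrable_finsetSum _ fun k' _ => hwwint k k'
  have hf2 : ∫ ξ, f ξ ^ 2 ∂(stdGaussianPi d) ≤ B := by
    simp_rw [hf2']
    rw [integral_finsetSum _ fun k _ => integrable_finsetSum _ fun k' _ => hwwint k k']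
    have : ∀ k, ∫ ξ, ∑ k', M⁻¹ ^ 2 * (w k ξ * w k' ξ) ∂(stdGaussianPi d) =
        ∑ k', M⁻¹ ^ 2 * Real.exp (∑ j, u k j * u k' j) := fun k => by
      rw [integral_finsetSum _ fun k' _ => hwwint k k']
      refine Finset.sum_congr rfl fun k' _ => ?_
      rw [integral_const_mul]
      simp_rw [hww]
      rw [integral_exp_linear_stdGaussianPi]
      congr 2
      simp_rw [add_sq, Finset.sum_add_distrib, mul_assoc, ← Finset.mul_sum]
      ring
    simp_rw [this, ← Finset.mul_sum]
    rw [inv_pow, inv_mul_le_iff₀ (by positivity), mul_comm]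
    exact hB
  -- Averaging `h1` over `k` and changing measure moves all the risks onto the law at zero, weighted
  -- by `f`.
  have hR1 : ∫⁻ ξ, ENNReal.ofReal (f ξ * (G ξ - r) ^ 2) ∂(stdGaussianPi d) ≤ R := by
    have hstep : ∀ ξ, ENNReal.ofReal (f ξ * (G ξ - r) ^ 2) =
        ∑ k, ENNReal.ofReal M⁻¹ * (ENNReal.ofReal (w k ξ) *
          ENNReal.ofReal ((G ξ - r) ^ 2)) := fun ξ => by
      rw [hf, Finset.sum_mul, ENNReal.ofReal_sum_of_nonneg]
      · refine Finset.sum_congr rfl fun k _ => ?_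
        rw [mul_assoc, ENNReal.ofReal_mul (by positivity), ENNReal.ofReal_mul (hwpos k ξ).le]
      · intro k _
        have := hwpos k ξ
        positivity
    simp_rw [hstep]
    rw [lintegral_finsetSum _ fun k _ => by have := hwm k; fun_prop]
    calc _ ≤ ∑ _k : K, ENNReal.ofReal M⁻¹ * R := by
          refine Finset.sum_le_sum fun k _ => ?_
          rw [lintegral_const_mul _ (by have := hwm k; fun_prop)]
          gcongr
          refine le_trans (le_of_eq ?_) (h1 k)
          exact (lintegral_add_stdGaussianPi (u k)
            (F := fun ξ => ENNReal.ofReal ((G ξ - r) ^ 2)) (by fun_prop)).symm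
      _ = R := by
          rw [Finset.sum_const, nsmul_eq_mul, ← mul_assoc, Finset.card_univ,
            ← ENNReal.ofReal_natCast, ← ENNReal.ofReal_mul (by positivity), ← hM,
            mul_inv_cancel₀ hMpos.ne', ENNReal.ofReal_one, one_mul]
  -- Since `f - f ^ 2 / 4 ≤ min 1 f`, a lower bound for the overlap needs only the first two moments
  -- of `f`. The positive part makes the integrand nonnegative, as passing to `∫⁻` requires.
  have hpt : ∀ ξ, max (r ^ 2 / 2 * (f ξ - f ξ ^ 2 / 4)) 0 ≤
      G ξ ^ 2 + f ξ * (G ξ - r) ^ 2 := fun ξ => by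
    have hnn := hfnn ξ
    refine max_le ?_ (by positivity)
    set x := f ξ
    set g := G ξ
    have e1 : x - x ^ 2 / 4 ≤ 1 := by nlinarith [sq_nonneg (x / 2 - 1)]
    have e2 : x - x ^ 2 / 4 ≤ x := by nlinarith [sq_nonneg x]
    rcases le_or_gt (x - x ^ 2 / 4) 0 with h | h
    · have : r ^ 2 / 2 * (x - x ^ 2 / 4) ≤ 0 :=
        mul_nonpos_of_nonneg_of_nonpos (by positivity) h
      have : 0 ≤ g ^ 2 + x * (g - r) ^ 2 := by positivity
      linarith
    · have a1 := mul_le_mul_of_nonneg_right e1 (sq_nonneg g)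
      have a2 := mul_le_mul_of_nonneg_right e2 (sq_nonneg (g - r))
      have a3 : r ^ 2 / 2 ≤ g ^ 2 + (g - r) ^ 2 := by nlinarith [sq_nonneg (2 * g - r)]
      have a4 := mul_le_mul_of_nonneg_left a3 h.le
      linarith
  have hint : Integrable (fun ξ => r ^ 2 / 2 * (f ξ - f ξ ^ 2 / 4)) (stdGaussianPi d) :=
    (hfint.sub (hf2int.div_const 4)).const_mul _
  have hlow : r ^ 2 / 2 * (1 - B / 4) ≤
      ∫ ξ, max (r ^ 2 / 2 * (f ξ - f ξ ^ 2 / 4)) 0 ∂(stdGaussianPi d) := by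
    calc r ^ 2 / 2 * (1 - B / 4)
        ≤ r ^ 2 / 2 * (1 - (∫ ξ, f ξ ^ 2 ∂(stdGaussianPi d)) / 4) := by gcongr
      _ = ∫ ξ, r ^ 2 / 2 * (f ξ - f ξ ^ 2 / 4) ∂(stdGaussianPi d) := by
          rw [integral_const_mul, integral_sub hfint (hf2int.div_const 4), hf1,
            integral_div]
      _ ≤ _ := integral_mono hint hint.pos_part fun ξ => le_max_left _ _
  have h2R : ENNReal.ofReal (r ^ 2 / 2 * (1 - B / 4)) ≤ 2 * R := by
    calc _ ≤ ENNReal.ofReal (∫ ξ, max (r ^ 2 / 2 * (f ξ - f ξ ^ 2 / 4)) 0 ∂(stdGaussianPi d)) :=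
          ENNReal.ofReal_le_ofReal hlow
      _ = ∫⁻ ξ, ENNReal.ofReal (max (r ^ 2 / 2 * (f ξ - f ξ ^ 2 / 4)) 0) ∂(stdGaussianPi d) :=
          ofReal_integral_eq_lintegral_ofReal hint.pos_part
            (Filter.Eventually.of_forall fun ξ => le_max_right _ _)
      _ ≤ ∫⁻ ξ, (ENNReal.ofReal (G ξ ^ 2) + ENNReal.ofReal (f ξ * (G ξ - r) ^ 2))
            ∂(stdGaussianPi d) := by
          refine lintegral_mono fun ξ => ?_
          rw [← ENNReal.ofReal_add (sq_nonneg _) (mul_nonneg (hfnn ξ) (sq_nonneg _))]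
          exact ENNReal.ofReal_le_ofReal (hpt ξ)
      _ ≤ R + R := by
          rw [lintegral_add_left (by fun_prop)]
          exact add_le_add h0 hR1
      _ = 2 * R := (two_mul R).symm
  have : (1 - B / 4) / 4 * r ^ 2 = 2⁻¹ * (r ^ 2 / 2 * (1 - B / 4)) := by ring
  rw [this, ENNReal.ofReal_mul (by norm_num), ENNReal.ofReal_inv_of_pos two_pos]
  calc _ ≤ (ENNReal.ofReal 2)⁻¹ * (2 * R) := by gcongr
    _ = R := by
      rw [← mul_assoc, ENNReal.ofReal_ofNat, ENNReal.inv_mul_cancel (by simp) (by simp), one_mul]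

/-- The sum over `i` of the vectors with the single non-zero entry `a` at position `p i`. -/
def spikes {s d : ℕ} (a : ℝ) (p : Fin s → Fin d) (j : Fin d) : ℝ :=
  ∑ i, if p i = j then a else 0

lemma sum_spikes_mul {s d : ℕ} (a : ℝ) (p : Fin s → Fin d) (v : Fin d → ℝ) :
    ∑ j, spikes a p j * v j = ∑ i, a * v (p i) := by
  simp_rw [spikes, Finset.sum_mul]
  rw [Finset.sum_comm]
  simp

lemma hammingNorm_spikes_le {s d : ℕ} (a : ℝ) (p : Fin s → Fin d) :
    hammingNorm (spikes a p) ≤ s := by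
  classical
  calc hammingNorm (spikes a p) ≤ (Finset.univ.image p).card := by
        refine Finset.card_le_card fun j hj => ?_
        simp only [Finset.mem_filter, Finset.mem_univ, true_and] at hj
        by_contra h
        refine hj (Finset.sum_eq_zero fun i _ => if_neg fun hi => h ?_)
        exact hi ▸ Finset.mem_image_of_mem p (Finset.mem_univ i)
    _ ≤ s := Finset.card_image_le.trans (by simp)

lemma sparse_block_lower_bound {s m d : ℕ} (hs : 1 ≤ s) (hm : 1 ≤ m) (hsm : s * m ≤ d)
    {G : (Fin d → ℝ) → ℝ} (hG : Measurable G) {R : ENNReal}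
    (hR : ∀ η ∈ sparseClass s d, ∫⁻ ξ, ENNReal.ofReal
      ((G (fun j => η j + ξ j) - ‖η‖) ^ 2) ∂(stdGaussianPi d) ≤ R) :
    ENNReal.ofReal ((1 - Real.exp 1 / 4) / 4 * (s * Real.log (1 + (m : ℝ) / s))) ≤ R := by
  have hs0 : (0 : ℝ) < s := by exact_mod_cast hs
  have hm0 : (0 : ℝ) < m := by exact_mod_cast hm
  -- With this height each block contributes `m - 1 + exp (a ^ 2) = m * (1 + 1 / s)`, and the `s`
  -- blocks together stay below `m ^ s * e`.
  set a := √(Real.log (1 + (m : ℝ) / s)) with ha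
  have hlog : 0 ≤ Real.log (1 + (m : ℝ) / s) := Real.log_nonneg (by
    have : 0 ≤ (m : ℝ) / s := by positivity
    linarith)
  have ha2 : a * a = Real.log (1 + (m : ℝ) / s) := Real.mul_self_sqrt hlog
  have hexp : Real.exp (a * a) = 1 + (m : ℝ) / s := by
    rw [ha2, Real.exp_log (by positivity)]
  obtain ⟨e⟩ : Nonempty (Fin s × Fin m ↪ Fin d) :=
    Function.Embedding.nonempty_of_card_le (by simpa using hsm)
  set u : (Fin s → Fin m) → Fin d → ℝ := fun k => spikes a fun i => e (i, k i) with hu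
  have hue : ∀ k i l, u k (e (i, l)) = if k i = l then a else 0 := by
    intro k i l
    simp only [hu, spikes, EmbeddingLike.apply_eq_iff_eq, Prod.mk.injEq]
    rw [Finset.sum_eq_single i]
    · simp
    · intro b _ hb
      simp [hb]
    · simp
  have hinner : ∀ k k', ∑ j, u k j * u k' j = ∑ i, if k' i = k i then a * a else 0 := by
    intro k k'
    rw [hu, sum_spikes_mul]
    refine Finset.sum_congr rfl fun i _ => ?_
    have := hue k' i (k i)
    rw [hu] at this
    rw [this, mul_ite, mul_zero]
  have hnorm : ∀ k, ‖(WithLp.toLp 2 (u k) : EuclideanSpace ℝ (Fin d))‖ ^ 2 = s * (a * a) := by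
    intro k
    rw [EuclideanSpace.real_norm_sq_eq]
    simp_rw [sq]
    rw [hinner]
    simp
  have hnorm' : ∀ k, ‖(WithLp.toLp 2 (u k) : EuclideanSpace ℝ (Fin d))‖ = √(s * (a * a)) := by
    intro k
    rw [← hnorm k, Real.sqrt_sq (norm_nonneg _)]
  have : Nonempty (Fin s → Fin m) := ⟨fun _ => ⟨0, hm⟩⟩
  have key := two_point_lower_bound u (B := Real.exp 1) (r := √(s * (a * a))) ?_ hG (R := R) ?_ ?_
  · rwa [Real.sq_sqrt (mul_nonneg hs0.le (mul_self_nonneg a)), ha2] at key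
  · have h1 : ∀ k k', Real.exp (∑ j, u k j * u k' j) =
        ∏ i, if k' i = k i then 1 + (m : ℝ) / s else 1 := by
      intro k k'
      rw [hinner, Real.exp_sum]
      refine Finset.prod_congr rfl fun i _ => ?_
      split_ifs
      · exact hexp
      · exact Real.exp_zero
    simp_rw [h1, sum_prod_ite_eq]
    have h2 : ((m : ℝ) - 1 + (1 + m / s)) ^ s = m ^ s * (1 + (s : ℝ)⁻¹) ^ s := by
      rw [← mul_pow]; congr 1; field_simp; ring
    have h3 : (1 + (s : ℝ)⁻¹) ^ s ≤ Real.exp 1 := by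
      have h4 : 1 + (s : ℝ)⁻¹ ≤ Real.exp (s : ℝ)⁻¹ := by
        rw [add_comm]; exact Real.add_one_le_exp _
      calc (1 + (s : ℝ)⁻¹) ^ s ≤ Real.exp (s : ℝ)⁻¹ ^ s := by gcongr
        _ = Real.exp 1 := by rw [← Real.exp_nat_mul, mul_inv_cancel₀ hs0.ne']
    rw [h2]
    simp only [Finset.sum_const, Finset.card_univ, nsmul_eq_mul, Fintype.card_pi,
      Fintype.card_fin, Finset.prod_const, Nat.cast_pow]
    calc (m : ℝ) ^ s * (m ^ s * (1 + (s : ℝ)⁻¹) ^ s) ≤ m ^ s * (m ^ s * Real.exp 1) := by gcongr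
      _ = _ := by ring
  · have := hR 0 (by simp [sparseClass, hammingNorm])
    simpa using this
  · intro k
    have := hR (WithLp.toLp 2 (u k)) (hammingNorm_spikes_le _ _)
    rw [hnorm'] at this
    exact this

/-- Because `1 + 2 * v ≤ (1 + v) ^ 2`, a factor two inside the logarithm costs at most a factor two
outside. This absorbs the rounding in `d / s`. -/
lemma half_log_le {u v : ℝ} (hu : 0 ≤ u) (h : u ≤ 2 * v) :
    Real.log (1 + u) / 2 ≤ Real.log (1 + v) := by
  have h1 : Real.log (1 + u) ≤ Real.log ((1 + v) ^ 2) :=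
    Real.log_le_log (by linarith) (by nlinarith [sq_nonneg v])
  rw [Real.log_pow] at h1
  push_cast at h1
  linarith

lemma sparse_lower_bound {s d : ℕ} (hs : 1 ≤ s) (hsd : s ≤ d)
    {G : (Fin d → ℝ) → ℝ} (hG : Measurable G) {R : ENNReal}
    (hR : ∀ η ∈ sparseClass s d, ∫⁻ ξ, ENNReal.ofReal
      ((G (fun j => η j + ξ j) - ‖η‖) ^ 2) ∂(stdGaussianPi d) ≤ R) :
    ENNReal.ofReal ((1 - Real.exp 1 / 4) / 8 * (s * Real.log (1 + (d : ℝ) / s ^ 2))) ≤ R := by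
  have hs0 : (0 : ℝ) < s := by exact_mod_cast hs
  have hm : 1 ≤ d / s := (Nat.one_le_div_iff hs).2 hsd
  refine le_trans (ENNReal.ofReal_le_ofReal ?_)
    (sparse_block_lower_bound hs hm (Nat.mul_div_le d s) hG hR)
  have hd : (d : ℝ) ≤ 2 * ((d / s : ℕ) * s) := by
    have h1 := Nat.div_add_mod d s
    have h2 := Nat.mod_lt d hs
    have h3 : s ≤ s * (d / s) := Nat.le_mul_of_pos_right s hm
    have : d ≤ 2 * ((d / s) * s) := by rw [mul_comm (d / s) s]; omega
    exact_mod_cast this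
  have h := half_log_le (u := (d : ℝ) / s ^ 2) (v := ((d / s : ℕ) : ℝ) / s) (by positivity) (by
    rw [← mul_div_assoc, div_le_div_iff₀ (by positivity) hs0]
    nlinarith)
  have hc : 0 < 1 - Real.exp 1 / 4 := by
    have := Real.exp_one_lt_d9; linarith
  calc _ = (1 - Real.exp 1 / 4) / 4 * (s * (Real.log (1 + (d : ℝ) / s ^ 2) / 2)) := by ring
    _ ≤ _ := by gcongr

lemma sparseClass_mono {s s' d : ℕ} (h : s ≤ s') : sparseClass s d ⊆ sparseClass s' d :=
  fun _ hθ => le_trans hθ h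

lemma normRate_eq_mul (s d : ℕ) (σ : ℝ) : normRate s d σ = σ ^ 2 * normRate s d 1 := by
  unfold normRate
  split_ifs <;> ring

lemma unit_noise_lower_bound {s d : ℕ} (hs : 1 ≤ s) (hsd : s ≤ d)
    {G : (Fin d → ℝ) → ℝ} (hG : Measurable G) {R : ENNReal}
    (hR : ∀ η ∈ sparseClass s d, ∫⁻ ξ, ENNReal.ofReal
      ((G (fun j => η j + ξ j) - ‖η‖) ^ 2) ∂(stdGaussianPi d) ≤ R) :
    ENNReal.ofReal ((1 - Real.exp 1 / 4) / 32 * normRate s d 1) ≤ R := by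
  have hc : 0 < 1 - Real.exp 1 / 4 := by
    have := Real.exp_one_lt_d9; linarith
  unfold normRate
  split_ifs with h
  · refine le_trans (ENNReal.ofReal_le_ofReal ?_) (sparse_lower_bound hs hsd hG hR)
    have : 0 ≤ Real.log (1 + (d : ℝ) / s ^ 2) := Real.log_nonneg (by
      have : 0 ≤ (d : ℝ) / s ^ 2 := by positivity
      linarith)
    calc _ = (1 - Real.exp 1 / 4) / 32 * (s * Real.log (1 + (d : ℝ) / s ^ 2)) := by ring
      _ ≤ _ := by gcongr; norm_num
  -- At sparsity `q = ⌊√d⌋ ≤ s` the logarithm is at least `log 2 > 1 / 2`, and `√d ≤ 2 * q`. These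
  -- two losses turn the constant `1 / 8` into `1 / 32`.
  · set q := Nat.sqrt d with hq
    have hd1 : 1 ≤ d := hs.trans hsd
    have hq1 : 1 ≤ q := Nat.sqrt_pos.2 hd1
    have hq1' : (1 : ℝ) ≤ q := by exact_mod_cast hq1
    have hqd : (q : ℝ) ^ 2 ≤ d := by
      have := Nat.sqrt_le' d
      exact_mod_cast this
    have hdq : (d : ℝ) ≤ (q + 1) ^ 2 := by
      have := (Nat.lt_succ_sqrt' d).le
      exact_mod_cast this
    have hqs : q ≤ s := by
      have h1 : √(d : ℝ) ≤ s := not_lt.1 h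
      have h2 : (q : ℝ) ≤ √(d : ℝ) := Real.le_sqrt_of_sq_le hqd
      exact_mod_cast h2.trans h1
    refine le_trans (ENNReal.ofReal_le_ofReal ?_) (sparse_lower_bound hq1 (hqs.trans hsd) hG
      fun η hη => hR η (sparseClass_mono hqs hη))
    have h1 : Real.log 2 ≤ Real.log (1 + (d : ℝ) / q ^ 2) := by
      refine Real.log_le_log two_pos ?_
      have : 1 ≤ (d : ℝ) / q ^ 2 := (one_le_div (by positivity)).2 hqd
      linarith
    have h2 : (1 : ℝ) / 2 ≤ Real.log (1 + (d : ℝ) / q ^ 2) := by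
      have := Real.log_two_gt_d9; linarith
    have h3 : √(d : ℝ) ≤ 2 * q := by
      exact Real.sqrt_le_iff.2 ⟨by positivity, by nlinarith⟩
    calc (1 - Real.exp 1 / 4) / 32 * (1 ^ 2 * √(d : ℝ))
        ≤ (1 - Real.exp 1 / 4) / 32 * (1 ^ 2 * (2 * q)) := by gcongr
      _ = (1 - Real.exp 1 / 4) / 8 * (q * (1 / 2)) := by ring
      _ ≤ _ := by gcongr

lemma minimaxRisk_lower_bound {s d : ℕ} (hs : 1 ≤ s) (hsd : s ≤ d) {σ : ℝ} (hσ : 0 < σ) :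
    ENNReal.ofReal ((1 - Real.exp 1 / 4) / 32 * normRate s d σ) ≤
      minimaxRisk σ (sparseClass s d) (fun θ => ‖θ‖) := by
  refine le_iInf₂ fun T hT => ?_
  have hσ2 : 0 < σ ^ 2 := by positivity
  have h := unit_noise_lower_bound hs hsd
    (G := fun z => T (fun j => σ * z j) / σ) (by fun_prop)
    (R := (ENNReal.ofReal (σ ^ 2))⁻¹ * maxRisk σ (sparseClass s d) (fun θ => ‖θ‖) T)
    fun η hη => by
      have h1 : ENNReal.ofReal (σ ^ 2) * ∫⁻ ξ, ENNReal.ofReal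
          ((T (fun j => σ * (η j + ξ j)) / σ - ‖η‖) ^ 2) ∂(stdGaussianPi d) ≤
          maxRisk σ (sparseClass s d) (fun θ => ‖θ‖) T := by
        rw [← lintegral_risk_smul hσ η hT]
        exact le_iSup₂_of_le (σ • η) (smul_mem_sparseClass σ hη) le_rfl
      rw [← ENNReal.mul_le_iff_le_inv (by simpa using hσ.ne') ENNReal.ofReal_ne_top]
      exact h1
  rw [← ENNReal.mul_le_iff_le_inv (by simpa using hσ.ne') ENNReal.ofReal_ne_top,
    ← ENNReal.ofReal_mul hσ2.le] at h
  rw [normRate_eq_mul]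
  rwa [mul_left_comm]

/-! ### Gaussian moments and tails. -/

lemma integrable_pow_gaussianReal (n : ℕ) :
    Integrable (fun t : ℝ => t ^ n) (gaussianReal 0 1) := by
  have h := (memLp_id_gaussianReal (μ := 0) (v := 1) n).integrable_norm_pow'
  refine h.mono' (by fun_prop) (Filter.Eventually.of_forall fun t => ?_)
  simp

lemma integrable_sq_sub_const_sq (c : ℝ) :
    Integrable (fun t : ℝ => (t ^ 2 - c) ^ 2) (gaussianReal 0 1) := by
  have h : (fun t : ℝ => (t ^ 2 - c) ^ 2) = fun t => t ^ 4 - 2 * c * t ^ 2 + c ^ 2 := by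
    ext t; ring
  rw [h]
  exact ((integrable_pow_gaussianReal 4).sub ((integrable_pow_gaussianReal 2).const_mul _)).add
    (integrable_const _)

lemma memLp_sq_sub_const (c : ℝ) :
    MemLp (fun t : ℝ => t ^ 2 - c) 2 (gaussianReal 0 1) :=
  (memLp_two_iff_integrable_sq (by fun_prop)).2 (integrable_sq_sub_const_sq c)

lemma integral_sq_gaussianReal : ∫ t, t ^ 2 ∂(gaussianReal 0 1) = 1 := by
  have h := variance_fun_id_gaussianReal (μ := 0) (v := 1)
  rw [variance_of_integral_eq_zero (by fun_prop) (by simp)] at h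
  simpa using h

lemma measurableSet_lt_abs (x : ℝ) : MeasurableSet {t : ℝ | x < |t|} :=
  measurableSet_lt measurable_const (by fun_prop)

/-- With `w = t ^ 2 - x ^ 2`, the square `w ^ 2` is absorbed by `exp (w / 4)`, and half of the decay
`exp (-w / 2)` survives. Since `w ≥ (|t| - x) ^ 2`, what remains is dominated by Gaussian profiles
of variance 2 centred at `±x`. -/
lemma sq_mul_exp_neg_half_le {x t : ℝ} (hx : 0 ≤ x) (ht : x < |t|) :
    (t ^ 2 - x ^ 2) ^ 2 * Real.exp (-t ^ 2 / 2) ≤ Real.exp (-x ^ 2 / 2) *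
      (32 * (Real.exp (-(t - x) ^ 2 / 4) + Real.exp (-(t - -x) ^ 2 / 4))) := by
  set w := t ^ 2 - x ^ 2 with hw
  have hsq : (|t| - x) ^ 2 ≤ w := by
    rw [hw, ← sq_abs t]; nlinarith
  have hw0 : 0 ≤ w := (sq_nonneg _).trans hsq
  have h1 : w ^ 2 ≤ 32 * Real.exp (w / 4) := by
    have := Real.quadratic_le_exp_of_nonneg (x := w / 4) (by positivity)
    nlinarith
  have h2 : Real.exp (-t ^ 2 / 2) = Real.exp (-x ^ 2 / 2) * Real.exp (-w / 2) := by
    rw [← Real.exp_add]; congr 1; rw [hw]; ring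
  have h3 : Real.exp (w / 4) * Real.exp (-w / 2) ≤
      Real.exp (-(t - x) ^ 2 / 4) + Real.exp (-(t - -x) ^ 2 / 4) := by
    have e1 : Real.exp (w / 4) * Real.exp (-w / 2) ≤ Real.exp (-(|t| - x) ^ 2 / 4) := by
      rw [← Real.exp_add]
      exact Real.exp_le_exp.2 (by linarith)
    refine e1.trans ?_
    rcases abs_cases t with ⟨h, _⟩ | ⟨h, _⟩
    · rw [h]
      have := Real.exp_pos (-(t - -x) ^ 2 / 4)
      linarith
    · rw [h]
      have := Real.exp_pos (-(t - x) ^ 2 / 4)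
      have e2 : (-t - x) ^ 2 = (t - -x) ^ 2 := by ring
      rw [e2]
      linarith
  calc w ^ 2 * Real.exp (-t ^ 2 / 2)
      ≤ 32 * Real.exp (w / 4) * (Real.exp (-x ^ 2 / 2) * Real.exp (-w / 2)) := by
        rw [h2]; gcongr
    _ = Real.exp (-x ^ 2 / 2) * (32 * (Real.exp (w / 4) * Real.exp (-w / 2))) := by ring
    _ ≤ _ := by gcongr

lemma setIntegral_sq_sub_sq_sq_le {x : ℝ} (hx : 0 ≤ x) :
    ∫ t in {t : ℝ | x < |t|}, (t ^ 2 - x ^ 2) ^ 2 ∂(gaussianReal 0 1) ≤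
      96 * Real.exp (-x ^ 2 / 2) := by
  have hA := measurableSet_lt_abs x
  rw [← integral_indicator hA, integral_gaussianReal_eq_integral_smul one_ne_zero]
  have hpdf : ∀ m t : ℝ, Real.exp (-(t - m) ^ 2 / 4) =
      √(2 * Real.pi * 2) * gaussianPDFReal m 2 t := by
    intro m t
    rw [gaussianPDFReal, ← mul_assoc]
    have : √(2 * Real.pi * 2) ≠ 0 := by positivity
    simp only [NNReal.coe_ofNat]
    rw [mul_inv_cancel₀ this, one_mul]
    congr 1
    ring
  have hs2 : √(2 * Real.pi)⁻¹ * √(2 * Real.pi * 2) = √2 := by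
    rw [Real.sqrt_mul (by positivity : 0 ≤ 2 * Real.pi), ← mul_assoc, ← Real.sqrt_mul (by positivity),
      inv_mul_cancel₀ (by positivity), Real.sqrt_one, one_mul]
  have hbound : ∀ t, gaussianPDFReal 0 1 t •
      ({t : ℝ | x < |t|}.indicator (fun t => (t ^ 2 - x ^ 2) ^ 2) t) ≤
      32 * √2 * Real.exp (-x ^ 2 / 2) * (gaussianPDFReal x 2 t + gaussianPDFReal (-x) 2 t) := by
    intro t
    by_cases ht : x < |t|
    · rw [Set.indicator_of_mem (by exact ht), smul_eq_mul]
      have h := sq_mul_exp_neg_half_le hx ht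
      rw [hpdf x, hpdf (-x)] at h
      have h' := mul_le_mul_of_nonneg_left h (Real.sqrt_nonneg (2 * Real.pi)⁻¹)
      calc _ = √(2 * Real.pi)⁻¹ * ((t ^ 2 - x ^ 2) ^ 2 * Real.exp (-t ^ 2 / 2)) := by
            simp [gaussianPDFReal]; ring
        _ ≤ _ := h'
        _ = (√(2 * Real.pi)⁻¹ * √(2 * Real.pi * 2)) * 32 * Real.exp (-x ^ 2 / 2) *
            (gaussianPDFReal x 2 t + gaussianPDFReal (-x) 2 t) := by ring
        _ = _ := by rw [hs2]; ring
    · rw [Set.indicator_of_notMem (by exact ht), smul_zero]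
      have h1 := gaussianPDFReal_nonneg x 2 t
      have h2 := gaussianPDFReal_nonneg (-x) 2 t
      positivity
  have hnn : ∀ t, 0 ≤ gaussianPDFReal 0 1 t •
      ({t : ℝ | x < |t|}.indicator (fun t => (t ^ 2 - x ^ 2) ^ 2) t) := fun t =>
    mul_nonneg (gaussianPDFReal_nonneg _ _ _) (Set.indicator_nonneg (fun _ _ => sq_nonneg _) _)
  refine (integral_mono_of_nonneg (Filter.Eventually.of_forall hnn)
    (((integrable_gaussianPDFReal x 2).add (integrable_gaussianPDFReal (-x) 2)).const_mul _)
    (Filter.Eventually.of_forall hbound)).trans ?_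
  rw [integral_const_mul]
  simp only [Pi.add_apply]
  rw [integral_add (integrable_gaussianPDFReal x 2)
    (integrable_gaussianPDFReal (-x) 2), integral_gaussianPDFReal_eq_one _ two_ne_zero,
    integral_gaussianPDFReal_eq_one _ two_ne_zero]
  have h2 : √2 ≤ 3 / 2 := Real.sqrt_le_iff.2 ⟨by norm_num, by norm_num⟩
  have := Real.exp_pos (-x ^ 2 / 2)
  nlinarith

/-- On an interval of length `1 / x` beyond `x`, `t ^ 2` grows by at most 3, so the density stays
comparable to its value at `x`. -/
lemma gaussianReal_tail_lower_bound {x : ℝ} (hx : 1 ≤ x) :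
    Real.exp (-x ^ 2 / 2) / (20 * x) ≤ (gaussianReal 0 1).real {t : ℝ | x < |t|} := by
  have hx0 : 0 < x := by linarith
  have hsub : Set.Ioc x (x + x⁻¹) ⊆ {t : ℝ | x < |t|} := fun t ht =>
    lt_of_lt_of_le ht.1 (le_abs_self t)
  refine le_trans ?_ (measureReal_mono hsub)
  rw [measureReal_def, gaussianReal_apply_eq_integral 0 one_ne_zero, ENNReal.toReal_ofReal
    (setIntegral_nonneg measurableSet_Ioc fun t _ => gaussianPDFReal_nonneg _ _ _)]
  have hpt : ∀ t ∈ Set.Ioc x (x + x⁻¹), Real.exp (-x ^ 2 / 2) / 20 ≤ gaussianPDFReal 0 1 t := by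
    intro t ht
    have ht0 : 0 < t := hx0.trans ht.1
    have hinv : x⁻¹ ≤ 1 := inv_le_one_of_one_le₀ hx
    have hinv0 : 0 < x⁻¹ := inv_pos.2 hx0
    have h1 : t ^ 2 ≤ x ^ 2 + 3 := by
      have h2 : t ^ 2 ≤ (x + x⁻¹) ^ 2 := by gcongr; exact ht.2
      have h3 : x * x⁻¹ = 1 := mul_inv_cancel₀ hx0.ne'
      nlinarith
    have h2 : Real.exp (-x ^ 2 / 2) * Real.exp (-3 / 2) ≤ Real.exp (-t ^ 2 / 2) := by
      rw [← Real.exp_add]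
      exact Real.exp_le_exp.2 (by linarith)
    have h3 : (1 : ℝ) / 6 ≤ Real.exp (-3 / 2) := by
      have e : Real.exp (-3 / 2) ^ 2 = (Real.exp 1 ^ 3)⁻¹ := by
        rw [← Real.exp_nat_mul, ← Real.exp_nat_mul, ← Real.exp_neg]; norm_num
      have e1 : Real.exp 1 ^ 3 ≤ 36 := by
        calc Real.exp 1 ^ 3 ≤ 3 ^ 3 := by gcongr; exact Real.exp_one_lt_three.le
          _ ≤ 36 := by norm_num
      refine le_of_sq_le_sq ?_ (Real.exp_pos _).le
      rw [e]
      calc ((1 : ℝ) / 6) ^ 2 = 36⁻¹ := by norm_num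
        _ ≤ _ := by gcongr
    have h4 : (1 : ℝ) / 3 ≤ (√(2 * Real.pi))⁻¹ := by
      rw [one_div]
      gcongr
      refine Real.sqrt_le_iff.2 ⟨by norm_num, ?_⟩
      have := Real.pi_lt_d2
      linarith
    have h5 : gaussianPDFReal 0 1 t = (√(2 * Real.pi))⁻¹ * Real.exp (-t ^ 2 / 2) := by
      simp [gaussianPDFReal]
    rw [h5]
    calc Real.exp (-x ^ 2 / 2) / 20 ≤ 1 / 3 * (Real.exp (-x ^ 2 / 2) * (1 / 6)) := by
          have := Real.exp_pos (-x ^ 2 / 2); linarith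
      _ ≤ (√(2 * Real.pi))⁻¹ * (Real.exp (-x ^ 2 / 2) * Real.exp (-3 / 2)) := by gcongr
      _ ≤ _ := by gcongr
  have h := setIntegral_mono_on (μ := volume) (s := Set.Ioc x (x + x⁻¹))
    (f := fun _ => Real.exp (-x ^ 2 / 2) / 20) (by simp)
    (integrable_gaussianPDFReal 0 1).integrableOn measurableSet_Ioc hpt
  refine le_trans (le_of_eq ?_) h
  rw [setIntegral_const]
  simp [measureReal_def, hx0.le]
  field_simp

/-! ### The threshold and the bias correction. -/

section Threshold

variable {s d : ℕ}

lemma exp_neg_threshold_sq (hs : 1 ≤ s) :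
    Real.exp (-threshold s d ^ 2 / 2) = (s : ℝ) ^ 2 / (s ^ 2 + d) := by
  have hs0 : (0 : ℝ) < s := by exact_mod_cast hs
  have h0 : 0 ≤ (d : ℝ) / s ^ 2 := by positivity
  rw [threshold, Real.sq_sqrt (mul_nonneg zero_le_two (Real.log_nonneg (by linarith))),
    neg_div, mul_div_cancel_left₀ _ two_ne_zero, Real.exp_neg, Real.exp_log (by linarith)]
  field_simp

lemma threshold_sq (s d : ℕ) : threshold s d ^ 2 = 2 * Real.log (1 + (d : ℝ) / s ^ 2) := by
  have h0 : 0 ≤ (d : ℝ) / s ^ 2 := by positivity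
  rw [threshold, Real.sq_sqrt (mul_nonneg zero_le_two (Real.log_nonneg (by linarith)))]

lemma one_le_threshold (hs : 1 ≤ s) (h : (s : ℝ) ^ 2 ≤ d) : 1 ≤ threshold s d := by
  have hs0 : (0 : ℝ) < s := by exact_mod_cast hs
  refine Real.le_sqrt_of_sq_le ?_
  have h1 : 1 ≤ (d : ℝ) / s ^ 2 := (one_le_div (by positivity)).2 h
  have h2 : Real.log 2 ≤ Real.log (1 + (d : ℝ) / s ^ 2) :=
    Real.log_le_log two_pos (by linarith)
  have := Real.log_two_gt_d9
  linarith

lemma alpha_nonneg (s d : ℕ) : 0 ≤ alpha s d :=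
  div_nonneg (integral_nonneg fun _ => sq_nonneg _) measureReal_nonneg

lemma tail_pos (hx : 1 ≤ threshold s d) :
    0 < (gaussianReal 0 1).real {t : ℝ | threshold s d < |t|} :=
  lt_of_lt_of_le (div_pos (Real.exp_pos _) (by linarith)) (gaussianReal_tail_lower_bound hx)

lemma alpha_mul_tail (hx : 1 ≤ threshold s d) :
    alpha s d * (gaussianReal 0 1).real {t : ℝ | threshold s d < |t|} =
      ∫ t in {t : ℝ | threshold s d < |t|}, t ^ 2 ∂(gaussianReal 0 1) :=
  div_mul_cancel₀ _ (tail_pos hx).ne'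

/-- Only the order `x ^ 2` matters. Integrating `t ^ 2 ≤ x ^ 2 + 1 + (t ^ 2 - x ^ 2) ^ 2` and
dividing by the tail probability costs `96 * 20 * x` in the last term. -/
lemma alpha_le (hx : 1 ≤ threshold s d) : alpha s d ≤ 1922 * threshold s d ^ 2 := by
  set x := threshold s d with hxdef
  have hA := measurableSet_lt_abs x
  set p := (gaussianReal 0 1).real {t : ℝ | x < |t|} with hp
  have hp0 : 0 < p := tail_pos hx
  have h1 : alpha s d * p ≤ (x ^ 2 + 1) * p + 96 * Real.exp (-x ^ 2 / 2) := by
    rw [hp, alpha_mul_tail hx]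
    calc _ ≤ ∫ t in {t : ℝ | x < |t|}, ((x ^ 2 + 1) + (t ^ 2 - x ^ 2) ^ 2) ∂(gaussianReal 0 1) := by
          refine setIntegral_mono_on (integrable_pow_gaussianReal 2).integrableOn
            ((integrable_const _).add (integrable_sq_sub_const_sq _)).integrableOn hA fun t _ => ?_
          nlinarith [sq_nonneg (t ^ 2 - x ^ 2 - 1), sq_nonneg (t ^ 2 - x ^ 2)]
      _ = (x ^ 2 + 1) * p + ∫ t in {t : ℝ | x < |t|}, (t ^ 2 - x ^ 2) ^ 2 ∂(gaussianReal 0 1) := by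
          rw [integral_add (integrable_const _) (integrable_sq_sub_const_sq _).integrableOn,
            setIntegral_const, smul_eq_mul, mul_comm]
      _ ≤ _ := by
          gcongr
          exact setIntegral_sq_sub_sq_sq_le (by linarith)
  have h2 : Real.exp (-x ^ 2 / 2) ≤ p * (20 * x) :=
    (div_le_iff₀ (by linarith)).1 (gaussianReal_tail_lower_bound hx)
  have h3 : alpha s d * p ≤ (x ^ 2 + 1 + 1920 * x) * p := by nlinarith
  have h4 := le_of_mul_le_mul_right h3 hp0
  nlinarith

/-- The contribution of a pure noise coordinate to the thresholded estimator. -/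
def noiseTerm (s d : ℕ) (t : ℝ) : ℝ :=
  if threshold s d < |t| then t ^ 2 - alpha s d else 0

lemma noiseTerm_eq_indicator (s d : ℕ) :
    noiseTerm s d = {t : ℝ | threshold s d < |t|}.indicator fun t => t ^ 2 - alpha s d := by
  ext t
  simp [noiseTerm, Set.indicator_apply]

lemma memLp_noiseTerm (s d : ℕ) : MemLp (noiseTerm s d) 2 (gaussianReal 0 1) := by
  rw [noiseTerm_eq_indicator]
  exact (memLp_sq_sub_const _).indicator (measurableSet_lt_abs _)

lemma integral_noiseTerm (hx : 1 ≤ threshold s d) :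
    ∫ t, noiseTerm s d t ∂(gaussianReal 0 1) = 0 := by
  rw [noiseTerm_eq_indicator, integral_indicator (measurableSet_lt_abs _),
    integral_sub (integrable_pow_gaussianReal 2).integrableOn (integrable_const _),
    ← alpha_mul_tail hx, setIntegral_const, smul_eq_mul]
  ring

/-- The conditional mean `alpha` minimises the squared deviation of `t ^ 2` on the event, so
replacing it by `x ^ 2` only increases the integral. -/
lemma integral_noiseTerm_sq_le (hx : 1 ≤ threshold s d) :
    ∫ t, noiseTerm s d t ^ 2 ∂(gaussianReal 0 1) ≤ 96 * Real.exp (-threshold s d ^ 2 / 2) := by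
  set x := threshold s d with hxdef
  have hA := measurableSet_lt_abs x
  have h1 : ∀ t, noiseTerm s d t ^ 2 =
      {t : ℝ | x < |t|}.indicator (fun t => (t ^ 2 - alpha s d) ^ 2) t := fun t => by
    rw [noiseTerm_eq_indicator]
    by_cases h : x < |t|
    · rw [Set.indicator_of_mem (by exact h), Set.indicator_of_mem (by exact h)]
    · rw [Set.indicator_of_notMem (by exact h), Set.indicator_of_notMem (by exact h)]
      norm_num
  simp_rw [h1]
  rw [integral_indicator hA]
  refine le_trans ?_ (setIntegral_sq_sub_sq_sq_le (by linarith : 0 ≤ x))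
  set c := alpha s d - x ^ 2 with hc
  have h2 : ∀ t : ℝ, (t ^ 2 - alpha s d) ^ 2 =
      (t ^ 2 - x ^ 2) ^ 2 - (2 * c * (t ^ 2 - alpha s d) + c ^ 2) := fun t => by
    rw [hc]; ring
  simp_rw [h2]
  have h3 : ∫ t in {t : ℝ | x < |t|}, (t ^ 2 - alpha s d) ∂(gaussianReal 0 1) = 0 := by
    rw [← integral_indicator hA, ← noiseTerm_eq_indicator]
    exact integral_noiseTerm hx
  have hi : IntegrableOn (fun t : ℝ => 2 * c * (t ^ 2 - alpha s d)) {t : ℝ | x < |t|}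
      (gaussianReal 0 1) :=
    (((integrable_pow_gaussianReal 2).sub (integrable_const _)).const_mul _).integrableOn
  have hi' : IntegrableOn (fun t : ℝ => 2 * c * (t ^ 2 - alpha s d) + c ^ 2) {t : ℝ | x < |t|}
      (gaussianReal 0 1) := hi.add (integrable_const _)
  rw [integral_sub (integrable_sq_sub_const_sq _).integrableOn hi',
    integral_add hi (integrable_const _), integral_const_mul, h3, setIntegral_const, smul_eq_mul]
  have : 0 ≤ (gaussianReal 0 1).real {t : ℝ | x < |t|} * c ^ 2 :=
    mul_nonneg measureReal_nonneg (sq_nonneg c)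
  linarith

end Threshold

/-! ### Measurability and scaling of the estimator. -/

lemma measurable_quadEstimator (s d : ℕ) (σ : ℝ) : Measurable (quadEstimator s d σ) := by
  unfold quadEstimator
  split_ifs
  · refine Finset.measurable_sum _ fun j _ => Measurable.ite ?_ (by fun_prop) measurable_const
    exact measurableSet_lt measurable_const (by fun_prop)
  · fun_prop

lemma measurable_normEstimator (s d : ℕ) (σ : ℝ) : Measurable (normEstimator s d σ) := by
  have := measurable_quadEstimator s d σ
  unfold normEstimator
  fun_prop

lemma quadEstimator_smul (s d : ℕ) {σ : ℝ} (hσ : 0 < σ) (z : Fin d → ℝ) :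
    quadEstimator s d σ (fun j => σ * z j) = σ ^ 2 * quadEstimator s d 1 z := by
  unfold quadEstimator
  split_ifs
  · rw [Finset.mul_sum]
    refine Finset.sum_congr rfl fun j _ => ?_
    rw [abs_mul, abs_of_pos hσ, one_mul, mul_ite, mul_zero]
    simp only [mul_lt_mul_iff_right₀ hσ]
    congr 1
    ring
  · simp_rw [mul_pow, ← Finset.mul_sum]
    ring

lemma normEstimator_smul (s d : ℕ) {σ : ℝ} (hσ : 0 < σ) (z : Fin d → ℝ) :
    normEstimator s d σ (fun j => σ * z j) = σ * normEstimator s d 1 z := by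
  unfold normEstimator
  rw [quadEstimator_smul s d hσ, ← mul_zero (σ ^ 2), ← mul_max_of_nonneg _ _ (sq_nonneg σ),
    Real.sqrt_mul (sq_nonneg σ), Real.sqrt_sq hσ.le, mul_zero]

lemma sqrt_sub_sqrt_sq_le {a b : ℝ} (ha : 0 ≤ a) (hb : 0 ≤ b) : (√a - √b) ^ 2 ≤ |a - b| := by
  have h : a - b = (√a - √b) * (√a + √b) := by
    rw [mul_comm, ← sq_sub_sq, Real.sq_sqrt ha, Real.sq_sqrt hb]
  rw [h, abs_mul, ← sq_abs, sq, abs_of_nonneg (by positivity : 0 ≤ √a + √b)]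
  refine mul_le_mul_of_nonneg_left ?_ (abs_nonneg _)
  rw [abs_le]
  constructor <;> linarith [Real.sqrt_nonneg a, Real.sqrt_nonneg b]

/-! ### The upper bound in the dense zone. -/

section Dense

/-- The root without `w` is an intermediate point `p`. Removing `w` costs `|w|`, while `|p ^ 2 - a ^
2| ≤ 2 * a * |β|` divided by `p + a ≥ a` gives `|p - a| ≤ 2 * |β|`, free of `a`. -/
lemma sqrt_quadratic_sub_sq_le {a β w : ℝ} (ha : 0 ≤ a) :
    (√(max (a ^ 2 + 2 * (a * β) + w) 0) - a) ^ 2 ≤ 8 * β ^ 2 + 2 * |w| := by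
  set p := √(max (a ^ 2 + 2 * (a * β)) 0) with hp
  have hp0 : 0 ≤ p := Real.sqrt_nonneg _
  have h1 : (√(max (a ^ 2 + 2 * (a * β) + w) 0) - p) ^ 2 ≤ |w| := by
    refine (sqrt_sub_sqrt_sq_le (le_max_right _ _) (le_max_right _ _)).trans ?_
    refine (abs_max_sub_max_le_abs _ _ 0).trans (le_of_eq ?_)
    congr 1; ring
  have h2 : (p - a) ^ 2 ≤ (2 * β) ^ 2 := by
    rcases ha.eq_or_lt with h0 | h0
    · have : p = 0 := by rw [hp, ← h0]; simp
      rw [this, ← h0]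
      nlinarith [sq_nonneg β]
    · have h3 : |p ^ 2 - a ^ 2| ≤ a * |2 * β| := by
        rw [hp, Real.sq_sqrt (le_max_right _ _)]
        have h4 := abs_max_sub_max_le_abs (a ^ 2 + 2 * (a * β)) (a ^ 2) 0
        rw [max_eq_left (sq_nonneg a)] at h4
        refine h4.trans (le_of_eq ?_)
        rw [← abs_of_pos h0, ← abs_mul, abs_of_pos h0]
        congr 1; ring
      have h5 : |p - a| * a ≤ |2 * β| * a := by
        calc |p - a| * a ≤ |p - a| * (p + a) := by gcongr; linarith
          _ = |p ^ 2 - a ^ 2| := by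
            rw [sq_sub_sq, abs_mul, abs_of_nonneg (by linarith : 0 ≤ p + a), mul_comm]
          _ ≤ _ := by rw [mul_comm]; exact h3
      exact sq_le_sq.2 (le_of_mul_le_mul_right h5 h0)
  nlinarith [sq_nonneg (√(max (a ^ 2 + 2 * (a * β) + w) 0) - p - (p - a))]

lemma lintegral_ofReal_le_of_le_integral {Ω : Type*} [MeasurableSpace Ω] {μ : Measure Ω}
    {F g : Ω → ℝ} (hF : ∀ ω, 0 ≤ F ω) (hFg : ∀ ω, F ω ≤ g ω) (hg : Integrable g μ) {b : ℝ}
    (hb : ∫ ω, g ω ∂μ ≤ b) : ∫⁻ ω, ENNReal.ofReal (F ω) ∂μ ≤ ENNReal.ofReal b := by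
  refine (lintegral_mono fun ω => ENNReal.ofReal_le_ofReal (hFg ω)).trans ?_
  rw [← ofReal_integral_eq_lintegral_ofReal hg
    (Filter.Eventually.of_forall fun ω => (hF ω).trans (hFg ω))]
  exact ENNReal.ofReal_le_ofReal hb

lemma dense_upper_bound {s d : ℕ} (hd : 1 ≤ d) (h : ¬ (s : ℝ) < √(d : ℝ))
    (η : EuclideanSpace ℝ (Fin d)) :
    ∫⁻ ξ, ENNReal.ofReal ((normEstimator s d 1 (fun j => η j + ξ j) - ‖η‖) ^ 2)
      ∂(stdGaussianPi d) ≤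
      ENNReal.ofReal ((9 + ∫ t, (t ^ 2 - 1) ^ 2 ∂(gaussianReal 0 1)) * √(d : ℝ)) := by
  set v := ∫ t, (t ^ 2 - 1) ^ 2 ∂(gaussianReal 0 1) with hv
  set r := √(d : ℝ) with hr
  have hd1 : (1 : ℝ) ≤ d := by exact_mod_cast hd
  have hr1 : 1 ≤ r := Real.one_le_sqrt.2 hd1
  have hrr : r ^ 2 = d := Real.sq_sqrt (by positivity)
  set a := ‖η‖ with ha
  have ha2 : a ^ 2 = ∑ j, η j ^ 2 := EuclideanSpace.real_norm_sq_eq η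
  set B : (Fin d → ℝ) → ℝ := fun ξ => ∑ j, η j / a * ξ j with hB
  set W : (Fin d → ℝ) → ℝ := fun ξ => ∑ j, (ξ j ^ 2 - 1) with hW
  have hBL : ∀ j : Fin d, MemLp (fun t : ℝ => η j / a * t) 2 (gaussianReal 0 1) := fun j =>
    (memLp_id_gaussianReal 2).const_mul _
  have hB2 : ∫ ξ, B ξ ^ 2 ∂(stdGaussianPi d) ≤ 1 := by
    rw [hB, integral_sq_sum_stdGaussianPi hBL fun j => by rw [integral_const_mul]; simp]
    simp_rw [mul_pow, integral_const_mul, integral_sq_gaussianReal, mul_one, div_pow]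
    rw [← Finset.sum_div, ← ha2]
    -- Also covers `η = 0`, where division by zero makes `B` vanish.
    exact div_self_le_one _
  have hW2 : ∫ ξ, W ξ ^ 2 ∂(stdGaussianPi d) = d * v := by
    rw [hW, integral_sq_sum_stdGaussianPi (fun _ => memLp_sq_sub_const 1) fun j => by
      rw [integral_sub (integrable_pow_gaussianReal 2) (integrable_const _),
        integral_sq_gaussianReal]; simp]
    simp [hv]
  have hBi : Integrable (fun ξ => B ξ ^ 2) (stdGaussianPi d) :=
    (memLp_sum_comp_eval_stdGaussianPi hBL).integrable_sq
  have hWi : Integrable (fun ξ => W ξ ^ 2) (stdGaussianPi d) :=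
    (memLp_sum_comp_eval_stdGaussianPi fun _ => memLp_sq_sub_const 1).integrable_sq
  have hgi1 : Integrable (fun ξ => 8 * B ξ ^ 2) (stdGaussianPi d) := hBi.const_mul _
  have hgi2 : Integrable (fun ξ => r⁻¹ * W ξ ^ 2 + r) (stdGaussianPi d) :=
    (hWi.const_mul _).add (integrable_const _)
  refine lintegral_ofReal_le_of_le_integral (g := fun ξ => 8 * B ξ ^ 2 + (r⁻¹ * W ξ ^ 2 + r))
    (fun _ => sq_nonneg _) (fun ξ => ?_) (hgi1.add hgi2) ?_
  · have hQ : quadEstimator s d 1 (fun j => η j + ξ j) = a ^ 2 + 2 * (a * B ξ) + W ξ := by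
      have haB : a * B ξ = ∑ j, η j * ξ j := by
        rw [hB, Finset.mul_sum]
        refine Finset.sum_congr rfl fun j _ => ?_
        by_cases h0 : a = 0
        · have : η = 0 := norm_eq_zero.1 h0
          simp [this]
        · field_simp
      have hWξ : W ξ = ∑ j, ξ j ^ 2 - d := by simp [hW]
      rw [quadEstimator, if_neg h, haB, ha2, hWξ]
      simp_rw [add_sq, Finset.sum_add_distrib, mul_assoc, ← Finset.mul_sum]
      ring
    rw [normEstimator, hQ]
    refine (sqrt_quadratic_sub_sq_le (norm_nonneg η)).trans ?_
    -- The weight `r = √d` balances the two terms, since `W ^ 2` has mean of order `d`.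
    have : 2 * |W ξ| ≤ r⁻¹ * W ξ ^ 2 + r := by
      have hr0 : 0 < r := by linarith
      rw [← sq_abs (W ξ), ← sub_nonneg]
      have : r⁻¹ * |W ξ| ^ 2 + r - 2 * |W ξ| = r⁻¹ * (|W ξ| - r) ^ 2 := by field_simp; ring
      rw [this]
      positivity
    linarith
  · rw [integral_add hgi1 hgi2, integral_const_mul,
      integral_add (hWi.const_mul _) (integrable_const _), integral_const_mul, hW2]
    have : r⁻¹ * (d * v) = v * r := by rw [← hrr]; field_simp
    rw [this]
    simp
    linarith

end Dense

/-! ### The upper bound in the sparse zone. -/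

section Sparse

lemma sparse_upper_bound {s d : ℕ} (hs : 1 ≤ s) (h : (s : ℝ) < √(d : ℝ))
    {η : EuclideanSpace ℝ (Fin d)} (hη : η ∈ sparseClass s d) :
    ∫⁻ ξ, ENNReal.ofReal ((normEstimator s d 1 (fun j => η j + ξ j) - ‖η‖) ^ 2)
      ∂(stdGaussianPi d) ≤
      ENNReal.ofReal (8000 * (s * Real.log (1 + (d : ℝ) / s ^ 2))) := by
  have hs0 : (0 : ℝ) < s := by exact_mod_cast hs
  have hsd : (s : ℝ) ^ 2 ≤ d := ((Real.lt_sqrt hs0.le).1 h).le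
  set x := threshold s d with hxdef
  have hx : 1 ≤ x := one_le_threshold hs hsd
  set α := alpha s d with hα
  have hα0 : 0 ≤ α := alpha_nonneg s d
  have hαx : α ≤ 1922 * x ^ 2 := alpha_le hx
  set S : Finset (Fin d) := Finset.univ.filter fun j => η j ≠ 0 with hS
  have hScard : (S.card : ℝ) ≤ s := by
    have : S.card ≤ s := hη
    exact_mod_cast this
  set g : Fin d → ℝ → ℝ := fun j t => if η j = 0 then noiseTerm s d t else 0 with hg
  have hgL : ∀ j, MemLp (g j) 2 (gaussianReal 0 1) := fun j => by
    by_cases h0 : η j = 0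
    · simpa [hg, h0] using memLp_noiseTerm s d
    · simp [hg, h0]
  have hg0 : ∀ j, ∫ t, g j t ∂(gaussianReal 0 1) = 0 := fun j => by
    by_cases h0 : η j = 0
    · simpa [hg, h0] using integral_noiseTerm hx
    · simp [hg, h0]
  have hg2 : ∀ j, ∫ t, g j t ^ 2 ∂(gaussianReal 0 1) ≤ 96 * Real.exp (-x ^ 2 / 2) := fun j => by
    by_cases h0 : η j = 0
    · simpa [hg, h0] using integral_noiseTerm_sq_le hx
    · simp [hg, h0]
      positivity
  set W : (Fin d → ℝ) → ℝ := fun ξ => ∑ j, g j (ξ j) with hW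
  have hWi : Integrable (fun ξ => W ξ ^ 2) (stdGaussianPi d) :=
    (memLp_sum_comp_eval_stdGaussianPi hgL).integrable_sq
  have hW2 : ∫ ξ, W ξ ^ 2 ∂(stdGaussianPi d) ≤ 96 * s ^ 2 := by
    rw [hW, integral_sq_sum_stdGaussianPi hgL hg0]
    calc _ ≤ ∑ _j : Fin d, 96 * Real.exp (-x ^ 2 / 2) := Finset.sum_le_sum fun j _ => hg2 j
      _ = 96 * (d * ((s : ℝ) ^ 2 / (s ^ 2 + d))) := by
          rw [hxdef, exp_neg_threshold_sq hs]; simp; ring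
      -- The threshold is tuned for this: `d * exp (-x ^ 2 / 2) ≤ s ^ 2`.
      _ ≤ 96 * s ^ 2 := by
          gcongr
          rw [← mul_div_assoc, div_le_iff₀ (by positivity)]
          nlinarith [sq_nonneg ((s : ℝ) ^ 2)]
  set U : (Fin d → ℝ) → ℝ := fun ξ => ∑ j ∈ S, (x ^ 2 + ξ j ^ 2) with hU
  have hUi1 : ∀ j, Integrable (fun ξ : Fin d → ℝ => x ^ 2 + ξ j ^ 2) (stdGaussianPi d) := fun j =>
    integrable_comp_eval_stdGaussianPi j (g := fun t => x ^ 2 + t ^ 2)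
      ((integrable_const _).add (integrable_pow_gaussianReal 2))
  have hUi : Integrable U (stdGaussianPi d) := integrable_finsetSum _ fun j _ => hUi1 j
  have hU1 : ∫ ξ, U ξ ∂(stdGaussianPi d) ≤ s * (x ^ 2 + 1) := by
    rw [hU, integral_finsetSum _ fun j _ => hUi1 j]
    have : ∀ j, ∫ ξ : Fin d → ℝ, (x ^ 2 + ξ j ^ 2) ∂(stdGaussianPi d) = x ^ 2 + 1 := fun j => by
      rw [integral_comp_eval_stdGaussianPi j (g := fun t => x ^ 2 + t ^ 2)
        ((integrable_const _).add (integrable_pow_gaussianReal 2)),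
        integral_add (integrable_const _) (integrable_pow_gaussianReal 2),
        integral_sq_gaussianReal]
      simp
    simp_rw [this]
    rw [Finset.sum_const, nsmul_eq_mul]
    gcongr
  have hgi1 : Integrable (fun ξ => (s : ℝ)⁻¹ * W ξ ^ 2 + (s + 2 * (α * s))) (stdGaussianPi d) :=
    (hWi.const_mul _).add (integrable_const _)
  refine lintegral_ofReal_le_of_le_integral
    (g := fun ξ => ((s : ℝ)⁻¹ * W ξ ^ 2 + (s + 2 * (α * s))) + 4 * U ξ)
    (fun _ => sq_nonneg _) (fun ξ => ?_) (hgi1.add (hUi.const_mul _)) ?_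
  · set y : Fin d → ℝ := fun j => η j + ξ j with hy
    -- The oracle vector: thresholded observations on the true support. `K` counts its surviving
    -- coordinates, each of which receives a superfluous correction `α`.
    set v : Fin d → ℝ := fun j => if η j ≠ 0 ∧ x < |y j| then y j else 0 with hv
    set vE : EuclideanSpace ℝ (Fin d) := WithLp.toLp 2 v with hvE
    set K : ℝ := ∑ j, if η j ≠ 0 ∧ x < |y j| then (1 : ℝ) else 0 with hK
    have hK0 : 0 ≤ K := Finset.sum_nonneg fun j _ => by split_ifs <;> norm_num
    have hKs : K ≤ s := by
      refine le_trans ?_ hScard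
      rw [hS, Finset.card_filter, hK]
      push_cast
      refine Finset.sum_le_sum fun j _ => ?_
      by_cases h0 : η j = 0
      · simp [h0]
      · simp only [ne_eq, h0, not_false_eq_true, true_and, if_true]
        split_ifs <;> norm_num
    have hvn : ‖vE‖ ^ 2 = ∑ j, v j ^ 2 := EuclideanSpace.real_norm_sq_eq vE
    have hQ : quadEstimator s d 1 y = ‖vE‖ ^ 2 + (W ξ - α * K) := by
      rw [quadEstimator, if_pos h, hvn, hW, hK, Finset.mul_sum, ← Finset.sum_sub_distrib,
        ← Finset.sum_add_distrib]
      refine Finset.sum_congr rfl fun j _ => ?_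
      simp only [hv, hg, one_mul, one_pow, mul_one, noiseTerm, ← hα, ← hxdef]
      by_cases h0 : η j = 0
      · have : y j = ξ j := by simp [hy, h0]
        simp [h0, this]
      · by_cases h1 : x < |y j|
        · simp [h0, h1]; ring
        · simp [h0, h1]
    have hN1 : (normEstimator s d 1 y - ‖vE‖) ^ 2 ≤ α * s + |W ξ| := by
      rw [normEstimator]
      have e1 := sqrt_sub_sqrt_sq_le (le_max_right (quadEstimator s d 1 y) 0)
        (sq_nonneg ‖vE‖)
      rw [Real.sqrt_sq (norm_nonneg _)] at e1
      refine e1.trans ?_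
      have e2 := abs_max_sub_max_le_abs (quadEstimator s d 1 y) (‖vE‖ ^ 2) 0
      rw [max_eq_left (sq_nonneg ‖vE‖)] at e2
      refine e2.trans ?_
      rw [hQ, add_sub_cancel_left]
      refine (abs_sub _ _).trans ?_
      rw [abs_of_nonneg (mul_nonneg hα0 hK0)]
      have : α * K ≤ α * s := by gcongr
      linarith
    -- On the support, a kept coordinate errs by `ξ j`, and a killed one by at most `x + |ξ j|`.
    have hN2 : (‖vE‖ - ‖η‖) ^ 2 ≤ 2 * U ξ := by
      have e1 : (‖vE‖ - ‖η‖) ^ 2 ≤ ‖vE - η‖ ^ 2 := by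
        rw [← sq_abs]
        gcongr
        exact abs_norm_sub_norm_le _ _
      refine e1.trans ?_
      rw [EuclideanSpace.real_norm_sq_eq, hU, Finset.mul_sum, hS, Finset.sum_filter]
      refine Finset.sum_le_sum fun j _ => ?_
      have e2 : (vE - η) j = v j - η j := rfl
      rw [e2]
      by_cases h0 : η j = 0
      · simp [hv, h0]
      · simp only [hv, ne_eq, h0, not_false_eq_true, true_and, if_true]
        split_ifs with h1
        · simp only [hy, add_sub_cancel_left]
          nlinarith [sq_nonneg x, sq_nonneg (ξ j)]
        · have e3 : y j ^ 2 ≤ x ^ 2 := by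
            rw [← sq_abs]
            have := not_lt.1 h1
            gcongr
          have e4 : η j = y j - ξ j := by simp [hy]
          rw [e4]
          nlinarith [sq_nonneg (y j + ξ j)]
    have hWs : 2 * |W ξ| ≤ (s : ℝ)⁻¹ * W ξ ^ 2 + s := by
      rw [← sq_abs (W ξ), ← sub_nonneg]
      have : (s : ℝ)⁻¹ * |W ξ| ^ 2 + s - 2 * |W ξ| = (s : ℝ)⁻¹ * (|W ξ| - s) ^ 2 := by
        field_simp; ring
      rw [this]
      positivity
    nlinarith [sq_nonneg ((normEstimator s d 1 y - ‖vE‖) - (‖vE‖ - ‖η‖))]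
  · rw [integral_add hgi1 (hUi.const_mul _), integral_const_mul,
      integral_add (hWi.const_mul _) (integrable_const _), integral_const_mul]
    have h1 : (s : ℝ)⁻¹ * ∫ ξ, W ξ ^ 2 ∂(stdGaussianPi d) ≤ 96 * s := by
      calc _ ≤ (s : ℝ)⁻¹ * (96 * s ^ 2) := by gcongr
        _ = 96 * s := by field_simp
    have h2 : α * s ≤ 1922 * x ^ 2 * s := by gcongr
    have h3 : (s : ℝ) ≤ s * x ^ 2 := le_mul_of_one_le_right hs0.le (by nlinarith)
    have h4 : (s : ℝ) * x ^ 2 = 2 * (s * Real.log (1 + (d : ℝ) / s ^ 2)) := by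
      rw [hxdef, threshold_sq]; ring
    simp only [integral_const, probReal_univ, one_smul]
    nlinarith

end Sparse

/-! ### Assembling the two zones and restoring `σ`. -/

lemma unit_noise_upper_bound {s d : ℕ} (hs : 1 ≤ s) (hsd : s ≤ d)
    {η : EuclideanSpace ℝ (Fin d)} (hη : η ∈ sparseClass s d) :
    ∫⁻ ξ, ENNReal.ofReal ((normEstimator s d 1 (fun j => η j + ξ j) - ‖η‖) ^ 2)
      ∂(stdGaussianPi d) ≤
      ENNReal.ofReal ((8000 + ∫ t, (t ^ 2 - 1) ^ 2 ∂(gaussianReal 0 1)) * normRate s d 1) := by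
  have hv : 0 ≤ ∫ t, (t ^ 2 - 1) ^ 2 ∂(gaussianReal 0 1) := integral_nonneg fun _ => sq_nonneg _
  unfold normRate
  split_ifs with h
  · refine (sparse_upper_bound hs h hη).trans (ENNReal.ofReal_le_ofReal ?_)
    have h0 : 0 ≤ (d : ℝ) / s ^ 2 := by positivity
    have : 0 ≤ Real.log (1 + (d : ℝ) / s ^ 2) := Real.log_nonneg (by linarith)
    rw [one_pow, one_mul]
    gcongr
    linarith
  · refine (dense_upper_bound (hs.trans hsd) h η).trans (ENNReal.ofReal_le_ofReal ?_)
    rw [one_pow, one_mul]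
    gcongr
    norm_num

lemma maxRisk_normEstimator_le {s d : ℕ} (hs : 1 ≤ s) (hsd : s ≤ d) {σ : ℝ} (hσ : 0 < σ) :
    maxRisk σ (sparseClass s d) (fun θ => ‖θ‖) (normEstimator s d σ) ≤
      ENNReal.ofReal ((8000 + ∫ t, (t ^ 2 - 1) ^ 2 ∂(gaussianReal 0 1)) * normRate s d σ) := by
  refine iSup₂_le fun θ hθ => ?_
  have hθσ : σ • (σ⁻¹ • θ) = θ := smul_inv_smul₀ hσ.ne' θ
  have h := lintegral_risk_smul hσ (σ⁻¹ • θ) (measurable_normEstimator s d σ)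
  rw [hθσ] at h
  rw [h, normRate_eq_mul, mul_left_comm, ENNReal.ofReal_mul (sq_nonneg σ)]
  gcongr
  refine le_trans (le_of_eq ?_) (unit_noise_upper_bound hs hsd (smul_mem_sparseClass σ⁻¹ hθ))
  refine lintegral_congr fun ξ => ?_
  rw [normEstimator_smul s d hσ, mul_div_cancel_left₀ _ hσ.ne']

end SparseNorm

end

theorem theorem6 :
    ∃ c C : ℝ, 0 < c ∧ 0 < C ∧
      ∀ s d : ℕ, 1 ≤ s → s ≤ d → ∀ σ : ℝ, 0 < σ →
        Measurable (SparseNorm.normEstimator s d σ) ∧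
        SparseNorm.maxRisk σ (SparseNorm.sparseClass s d) (fun θ => ‖θ‖)
            (SparseNorm.normEstimator s d σ) ≤
          ENNReal.ofReal (C * SparseNorm.normRate s d σ) ∧
        ENNReal.ofReal (c * SparseNorm.normRate s d σ) ≤
          SparseNorm.minimaxRisk σ (SparseNorm.sparseClass s d) (fun θ => ‖θ‖) := by
  -- The lower constant is positive because `e < 4`. In the upper one, 8000 serves the sparse zone
  -- and also dominates the 9 of the dense zone, whose fourth-moment integral is left unevaluated.
  refine ⟨(1 - Real.exp 1 / 4) / 32, 8000 + ∫ t, (t ^ 2 - 1) ^ 2 ∂(gaussianReal 0 1), ?_, ?_,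
    fun s d hs hsd σ hσ => ⟨SparseNorm.measurable_normEstimator s d σ,
      SparseNorm.maxRisk_normEstimator_le hs hsd hσ,
      SparseNorm.minimaxRisk_lower_bound hs hsd hσ⟩⟩
  · have := Real.exp_one_lt_d9
    linarith
  · have : 0 ≤ ∫ t, (t ^ 2 - 1) ^ 2 ∂(gaussianReal 0 1) := integral_nonneg fun _ => sq_nonneg _
    linarith
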